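/- Let $m,d\in\mathbb{N}_0$, let $\Theta\subseteq\mathbb{R}^m$ be nonempty and compact, and let $G:\Theta\times\mathbb{R}^d\to\mathbb{R}$. Let $(Z_j)_{j\in\mathbb{N}}$ be independent $\mathbb{R}^d$-valued random vectors on a complete probability space $(\Omega,\mathcal F,\mathbb P)$, all with the same law $\mathbb{P}^Z$. Assume: (A1) $G(\theta,\cdot)$ is Borel measurable for every $\theta\in\Theta$. (A2) $\xi:\mathbb{R}^d\to\mathbb{R}$ is a strictly positive, Borel measurable, $\mathbb{P}^Z$-integrable function with $\sup_{\theta\in\Theta}|G(\theta,z)|\le\xi(z)$ for all $z\in\mathbb{R}^d$. (A3) There are an at most countable set $\overline\Theta\subseteq\Theta$ and $(\mathbb{P}^Z)^n$-null sets $N_n$ ($n\in\mathbb{N}$) such that $$\inf_{\vartheta\in\overline\Theta}\big|\mathbb{E}[G(\vartheta,Z_1)]-\mathbb{E}[G(\theta,Z_1)]\big|=\inf_{\vartheta\in\overline\Theta}\max_{1\le j\le n}\big|G(\theta,z_j)-G(\vartheta,z_j)\big|=0$$ for all $n\in\mathbb{N}$, $\theta\in\Theta$ and $(z_1,\dots,z_n)\in\mathbb{R}^{dn}\setminus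 N_n$ (with $\inf\emptyset=\infty$). For a nonempty set $\mathbb F$ of Borel functions on $\mathbb{R}^d$ and a probability measure $\mathbb Q$ on $\mathbb R^d$, let $N(\eta,\mathbb F,L^2(\mathbb Q))\in\mathbb{N}\cup\{\infty\}$ be the minimal number of closed $L^2(\mathbb Q)$-balls of radius $\eta$ with centers in $\mathbb F$ needed to cover $\mathbb F$, and for a strictly positive Borel function $C$ with $|h|\le C$ for all $h\in\mathbb F$ put $$J(\mathbb F,C,\delta):=\int_0^\delta\ \sup_{\mathbb Q}\sqrt{\ln\big(2N(\varepsilon\|C\|_{\mathbb Q,2},\mathbb F,L^2(\mathbb Q))\big)}\,d\varepsilon\in[0,\infty],$$ where the supremum is over all Borel probability measures $\mathbb Q$ on $\mathbb{R}^d$ with finite support and $\|C\|_{\mathbb Q,2}=(\int C^2\,d\mathbb Q)^{1/2}$. Theorem. If, in addition, $\xi$ is square $\mathbb{P}^Z$-integrable and $J(\mathbb F^\Theta,\xi,1/2)<\infty$ for $\mathbb F^\Theta:=\{G(\theta,\cdot)\mid\theta\in\Theta\}$, then $$\sqrt n\,\Big[\inf_{\theta\in\Theta}\frac1n\sum_{j=1}^nG(\theta,Z_j)-\inf_{\theta\in\Theta}\mathbb{E}[G(\theta,Z_1)]\Big]\qquad(n\in\mathbb{N})$$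 is a sequence of random variables (that is, $\mathcal F$-measurable) that is uniformly tight: for every $\eta>0$ there is a compact $K\subset\mathbb{R}$ such that for every $n\in\mathbb{N}$ the $n$-th term lies outside $K$ with probability at most $\eta$. No Lipschitz continuity (or continuity) of the paths $G(\cdot,z)$ is assumed. -/

import Mathlib

open MeasureTheory ProbabilityTheory
open scoped ENNReal

namespace SAA

/-- The Euclidean space `ℝ^k`. -/
abbrev Euc (k : ℕ) : Type := EuclideanSpace ℝ (Fin k)

/-- The covering number `N(η, 𝔽, L^p(Q))`: the minimal number of closed balls of radius `η`
with respect to the `L^p(Q)`-distance, with centers in `𝔽`, needed to cover `𝔽`; it is `⊤` if there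
is no finite cover. -/
noncomputable def coveringNumber {d : ℕ} (η : ℝ≥0∞) (F : Set (Euc d → ℝ)) (p : ℝ≥0∞)
    (Q : Measure (Euc d)) : ℕ∞ :=
  ⨅ (C : Set (Euc d → ℝ)) (_ : C ⊆ F) (_ : ∀ f ∈ F, ∃ g ∈ C, eLpNorm (f - g) p Q ≤ η), C.encard

/-- The probability measures on the Borel sets of `ℝ^d` with finite support. -/
def finSuppMeasures (d : ℕ) : Set (Measure (Euc d)) :=
  {Q | IsProbabilityMeasure Q ∧ ∃ s : Set (Euc d), s.Finite ∧ Q sᶜ = 0}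

/-- The value `√(ln (2 N))` for `N ∈ ℕ ∪ {∞}`, with value `∞` at `N = ∞`. -/
noncomputable def sqrtLog (N : ℕ∞) : ℝ≥0∞ :=
  if N = ⊤ then ⊤ else ENNReal.ofReal (Real.sqrt (Real.log (2 * (N.toNat : ℝ))))

/-- The uniform entropy integral
`J(𝔽, C, δ) = ∫_0^δ sup_Q √(ln (2 N(ε ‖C‖_{Q,2}, 𝔽, L²(Q)))) dε`, the supremum being over all
probability measures `Q` with finite support, as an element of `[0, ∞]`. -/
noncomputable def entropyIntegral {d : ℕ} (F : Set (Euc d → ℝ)) (C : Euc d → ℝ) (δ : ℝ) : ℝ≥0∞ :=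
  ∫⁻ ε in Set.Ioc 0 δ, ⨆ Q ∈ finSuppMeasures d,
    sqrtLog (coveringNumber (ENNReal.ofReal ε * eLpNorm C 2 Q) F 2 Q)

/-- The function class `{G(θ, ·) | θ ∈ Θ}`. -/
def objectiveClass {m d : ℕ} (Θ : Set (Euc m)) (G : Euc m → Euc d → ℝ) : Set (Euc d → ℝ) :=
  {h | ∃ θ ∈ Θ, h = G θ}

/-- `G(θ, ·)` is Borel measurable for every `θ ∈ Θ`. -/
def MeasurableObjective {m d : ℕ} (Θ : Set (Euc m)) (G : Euc m → Euc d → ℝ) : Prop :=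
  ∀ θ ∈ Θ, Measurable (G θ)

/-- `ξ` is a strictly positive Borel function, integrable under `PZ`, with
`sup_{θ ∈ Θ} |G(θ, z)| ≤ ξ(z)` for all `z`. -/
def IntegrablePositiveEnvelope {m d : ℕ} (Θ : Set (Euc m)) (G : Euc m → Euc d → ℝ)
    (PZ : Measure (Euc d)) (ξ : Euc d → ℝ) : Prop :=
  Measurable ξ ∧ (∀ z, 0 < ξ z) ∧ Integrable ξ PZ ∧ ∀ z, ∀ θ ∈ Θ, |G θ z| ≤ ξ z

/-- There are an at most countable `Θ₀ ⊆ Θ` and `PZ^n`-null sets `N n`, `n ≥ 1`, with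
`inf_{ϑ ∈ Θ₀} |E[G(ϑ, Z)] - E[G(θ, Z)]| = inf_{ϑ ∈ Θ₀} max_j |G(θ, z_j) - G(ϑ, z_j)| = 0`
for all `n ≥ 1`, `θ ∈ Θ` and `(z_1, …, z_n) ∉ N n`. The infima are taken in `[0, ∞]`, so that an
infimum over the empty set is `∞`. -/
def CountablyDetermined {m d : ℕ} (Θ : Set (Euc m)) (G : Euc m → Euc d → ℝ)
    (PZ : Measure (Euc d)) [IsProbabilityMeasure PZ] : Prop :=
  ∃ Θ₀ : Set (Euc m), Θ₀ ⊆ Θ ∧ Θ₀.Countable ∧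
    ∃ N : (n : ℕ) → Set (Fin n → Euc d),
      (∀ n, 1 ≤ n → Measure.pi (fun _ : Fin n => PZ) (N n) = 0) ∧
      ∀ n, 1 ≤ n → ∀ θ ∈ Θ, ∀ z : Fin n → Euc d, z ∉ N n →
        (⨅ ϑ ∈ Θ₀, edist (∫ x, G ϑ x ∂PZ) (∫ x, G θ x ∂PZ)) = 0 ∧
        (⨅ ϑ ∈ Θ₀, ⨆ j : Fin n, edist (G θ (z j)) (G ϑ (z j))) = 0

/-- The optimal value `inf_{θ ∈ Θ} E[G(θ, Z)]` of the genuine program. -/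
noncomputable def optValue {m d : ℕ} (Θ : Set (Euc m)) (G : Euc m → Euc d → ℝ)
    (PZ : Measure (Euc d)) : ℝ :=
  ⨅ θ : Θ, ∫ z, G θ z ∂PZ

/-- The optimal value `inf_{θ ∈ Θ} (1/n) ∑_j G(θ, Z_j)` of the sample average approximation with the
sample of the first `n` members of the sequence `Z` (which is indexed from `0`). -/
noncomputable def sampleOptValue {m d : ℕ} {Ω : Type*} (Θ : Set (Euc m)) (G : Euc m → Euc d → ℝ)
    (Z : ℕ → Ω → Euc d) (n : ℕ) (ω : Ω) : ℝ :=
  ⨅ θ : Θ, (1 / (n : ℝ)) * ∑ j ∈ Finset.range n, G θ (Z j ω)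

/-- The scaled error `√n [SAA optimal value - genuine optimal value]`. -/
noncomputable def scaledError {m d : ℕ} {Ω : Type*} (Θ : Set (Euc m)) (G : Euc m → Euc d → ℝ)
    (PZ : Measure (Euc d)) (Z : ℕ → Ω → Euc d) (n : ℕ) (ω : Ω) : ℝ :=
  Real.sqrt n * (sampleOptValue Θ G Z n ω - optValue Θ G PZ)

end SAA

/-!
The infima in the condition of countable determination allow both optimal values to be computed over
the countable set `Θ₀`: for the sample average this holds for almost every sample
(`SAA.iInf_mean_eq_iInf`), for the genuine program always (`SAA.optValue_eq_iInf`). The two parts of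
the condition are used separately, so no parameter in `Θ₀` has to approximate a given `θ` for both
criteria. On a complete space the scaled error is then measurable, being almost everywhere equal to
a countable infimum, and its modulus is at most `n^(-1/2)` times the supremum over `Θ₀` of the
centered sums `∑ j, (G θ (Z j) - E[G θ Z])` (`SAA.enorm_sqrt_mul_iInf_sub_iInf_le`). By Markov's
inequality it suffices to bound the expectation of this supremum by a constant times `√n`.

Symmetrization (`SAA.lintegral_biSup_centered_le`) replaces the centered sums by Rademacher sums.
For a fixed sample, Hoeffding's bound on the moment generating function gives Massart's maximal
inequality for finite classes (`SAA.rademacherAverage_le_of_finite`). Chaining along minimal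
covers of dyadic radii with respect to the empirical measure, a probability measure with finite
support, bounds the Rademacher average by the uniform entropy integral times
`√(∑ j, ξ (z j) ^ 2)` (`SAA.rademacherAverage_le_entropyIntegral`). The expectation of this root is
of order `√n`, because `ξ` is square integrable. Working with Lebesgue integrals in `[0, ∞]`
throughout makes the integrability of suprema over countable classes irrelevant.
-/

namespace SAA

/-! ### Rademacher averages -/

/-- The real number `1` or `-1` encoded by a Boolean. -/
def sgn (b : Bool) : ℝ := if b then 1 else -1

/-- The Rademacher average of a class `A` of functions at the sample `z`: the mean over all
`2 ^ n` sign vectors `s` of `sup_{f ∈ A} |∑ j, s j * f (z j)|`, without normalization by `n`. -/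
noncomputable def rademacherAverage {α : Type*} {n : ℕ} (A : Set (α → ℝ)) (z : Fin n → α) : ℝ≥0∞ :=
  (2 ^ n)⁻¹ * ∑ s : Fin n → Bool, ⨆ f ∈ A, ‖∑ j, sgn (s j) * f (z j)‖ₑ

lemma abs_sgn (b : Bool) : |sgn b| = 1 := by
  cases b <;> simp [sgn]

/-- Hoeffding's bound for the moment generating function of a Rademacher sum. -/
lemma sum_exp_sgn_le {n : ℕ} (a : Fin n → ℝ) :
    ∑ s : Fin n → Bool, Real.exp (∑ j, sgn (s j) * a j) ≤
      2 ^ n * Real.exp ((∑ j, a j ^ 2) / 2) := by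
  have h1 : ∑ s : Fin n → Bool, Real.exp (∑ j, sgn (s j) * a j) =
      ∏ j, ∑ b : Bool, Real.exp (sgn b * a j) := by
    rw [Finset.prod_univ_sum, Fintype.piFinset_univ]
    simp [Real.exp_sum]
  have h2 : ∀ j, ∑ b : Bool, Real.exp (sgn b * a j) = 2 * Real.cosh (a j) := by
    intro j
    simp [sgn, Real.cosh_eq]
    ring
  rw [h1]
  simp_rw [h2]
  rw [Finset.prod_mul_distrib, Finset.sum_div, Real.exp_sum]
  simp only [Finset.prod_const, Finset.card_univ, Fintype.card_fin]
  gcongr with j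
  exact Real.cosh_le_exp_half_sq _

/-- Massart's maximal inequality for Rademacher averages of finite classes. -/
lemma rademacherAverage_le_of_finite {α : Type*} {n : ℕ} {A : Set (α → ℝ)} (hA : A.Finite)
    (z : Fin n → α) {N : ℕ} (hN : 1 ≤ N) (hAN : A.ncard ≤ N) {σ : ℝ} (hσ : 0 < σ)
    (hz : ∀ f ∈ A, ∑ j, f (z j) ^ 2 ≤ σ ^ 2) :
    rademacherAverage A z ≤ ENNReal.ofReal (σ * √(2 * Real.log (2 * N))) := by
  classical
  rcases A.eq_empty_or_nonempty with rfl | hne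
  · simp [rademacherAverage]
  set T := hA.toFinset with hT
  have hTne : T.Nonempty := by simpa [hT] using hne
  set X : (α → ℝ) → (Fin n → Bool) → ℝ := fun f s => ∑ j, sgn (s j) * f (z j) with hX
  choose g hgT hg using fun s => Finset.exists_max_image T (fun f => |X f s|) hTne
  have hTA : ∀ f, f ∈ T ↔ f ∈ A := fun f => by simp [hT]
  set D : ℝ := 2 * Real.log (2 * N) with hD
  have hN' : (1 : ℝ) ≤ N := by exact_mod_cast hN
  have hDpos : 0 < D := by
    have : 0 < Real.log (2 * N) := Real.log_pos (by linarith)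
    positivity
  -- the optimal exponent in the Chernoff bound
  set l : ℝ := √D / σ with hl
  have hlpos : 0 < l := by positivity
  have hlsq : l ^ 2 * σ ^ 2 = D := by
    rw [hl, div_pow, Real.sq_sqrt hDpos.le]
    field_simp
  have hmgf : ∀ f ∈ T, ∀ c : ℝ, c ^ 2 = l ^ 2 →
      ∑ s, Real.exp (c * X f s) ≤ 2 ^ n * Real.exp (D / 2) := by
    intro f hf c hc
    have h := sum_exp_sgn_le (fun j => c * f (z j))
    have e : ∀ s : Fin n → Bool, ∑ j, sgn (s j) * (c * f (z j)) = c * X f s := by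
      intro s
      rw [hX, Finset.mul_sum]
      exact Finset.sum_congr rfl fun j _ => by ring
    simp_rw [e] at h
    refine h.trans ?_
    gcongr
    simp_rw [mul_pow]
    rw [← Finset.mul_sum, hc, ← hlsq]
    have := hz f ((hTA f).1 hf)
    gcongr
  have hsum : ∑ s, Real.exp (l * |X (g s) s|) ≤ N * (2 * (2 ^ n * Real.exp (D / 2))) := by
    calc ∑ s, Real.exp (l * |X (g s) s|)
        ≤ ∑ s, ∑ f ∈ T, (Real.exp (l * X f s) + Real.exp (-l * X f s)) := by
          refine Finset.sum_le_sum fun s _ => ?_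
          refine le_trans ?_ (Finset.single_le_sum
            (f := fun f => Real.exp (l * X f s) + Real.exp (-l * X f s))
            (fun f _ => by positivity) (hgT s))
          rcases abs_cases (X (g s) s) with ⟨h, _⟩ | ⟨h, _⟩
          · rw [h]
            linarith [Real.exp_pos (-l * X (g s) s)]
          · rw [h, mul_neg, ← neg_mul]
            linarith [Real.exp_pos (l * X (g s) s)]
      _ = ∑ f ∈ T, (∑ s, Real.exp (l * X f s) + ∑ s, Real.exp (-l * X f s)) := by
          rw [Finset.sum_comm]
          simp_rw [Finset.sum_add_distrib]
      _ ≤ ∑ f ∈ T, 2 * (2 ^ n * Real.exp (D / 2)) := by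
          refine Finset.sum_le_sum fun f hf => ?_
          linarith [hmgf f hf l rfl, hmgf f hf (-l) (by ring)]
      _ ≤ N * (2 * (2 ^ n * Real.exp (D / 2))) := by
          rw [Finset.sum_const, nsmul_eq_mul]
          have : T.card ≤ N := by rwa [hT, ← Set.ncard_eq_toFinset_card A hA]
          gcongr
  have hexpD : Real.exp (D / 2) = 2 * N := by
    rw [hD, mul_div_cancel_left₀ _ (two_ne_zero), Real.exp_log (by positivity)]
  -- `x ≤ D - 1 + exp (x - D)` replaces Jensen's inequality
  have hmean : ∑ s, |X (g s) s| ≤ 2 ^ n * (σ * √D) := by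
    have h1 : ∀ s, l * |X (g s) s| ≤ D - 1 + Real.exp (-D) * Real.exp (l * |X (g s) s|) := by
      intro s
      rw [← Real.exp_add]
      linarith [Real.add_one_le_exp (-D + l * |X (g s) s|)]
    have h2 : l * ∑ s, |X (g s) s| ≤ 2 ^ n * D := by
      rw [Finset.mul_sum]
      refine (Finset.sum_le_sum fun s _ => h1 s).trans ?_
      rw [Finset.sum_add_distrib, ← Finset.mul_sum, Finset.sum_const, nsmul_eq_mul]
      have h3 : Real.exp (-D) * ∑ s, Real.exp (l * |X (g s) s|) ≤ 2 ^ n := by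
        refine (mul_le_mul_of_nonneg_left hsum (Real.exp_pos _).le).trans ?_
        have : Real.exp (-D) * Real.exp (D / 2) * Real.exp (D / 2) = 1 := by
          rw [← Real.exp_add, ← Real.exp_add, Real.exp_eq_one_iff]
          ring
        apply le_of_eq
        calc Real.exp (-D) * (N * (2 * (2 ^ n * Real.exp (D / 2))))
            = Real.exp (-D) * Real.exp (D / 2) * (2 * N) * 2 ^ n := by ring
          _ = 2 ^ n := by rw [← hexpD, this, one_mul]
      simp only [Finset.card_univ, Fintype.card_pi, Fintype.card_bool, Finset.prod_const,
        Fintype.card_fin, Nat.cast_pow, Nat.cast_ofNat]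
      linarith
    have h4 : l * (2 ^ n * (σ * √D)) = 2 ^ n * D := by
      rw [hl]
      field_simp
      rw [Real.sq_sqrt hDpos.le]
    exact le_of_mul_le_mul_left (h2.trans_eq h4.symm) hlpos
  have hsup : ∀ s, (⨆ f ∈ A, ‖X f s‖ₑ) ≤ ENNReal.ofReal |X (g s) s| := by
    intro s
    refine iSup₂_le fun f hf => ?_
    rw [Real.enorm_eq_ofReal_abs]
    exact ENNReal.ofReal_le_ofReal (hg s f ((hTA f).2 hf))
  calc rademacherAverage A z ≤ (2 ^ n)⁻¹ * ∑ s, ENNReal.ofReal |X (g s) s| := by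
        unfold rademacherAverage
        gcongr with s
        exact hsup s
    _ = (2 ^ n)⁻¹ * ENNReal.ofReal (∑ s, |X (g s) s|) := by
        rw [ENNReal.ofReal_sum_of_nonneg fun s _ => abs_nonneg _]
    _ ≤ (2 ^ n)⁻¹ * ENNReal.ofReal (2 ^ n * (σ * √D)) := by gcongr
    _ = ENNReal.ofReal (σ * √D) := by
        rw [ENNReal.ofReal_mul (by positivity), ← mul_assoc, ENNReal.ofReal_pow (by norm_num)]
        simp only [ENNReal.ofReal_ofNat]
        rw [ENNReal.inv_mul_cancel (by positivity) (by simp), one_mul]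

lemma rademacherAverage_le_of_forall {α : Type*} {n : ℕ} {A : Set (α → ℝ)} {z : Fin n → α}
    {c : ℝ≥0∞} (h : ∀ s : Fin n → Bool, ∀ f ∈ A, ‖∑ j, sgn (s j) * f (z j)‖ₑ ≤ c) :
    rademacherAverage A z ≤ c := by
  calc rademacherAverage A z ≤ (2 ^ n)⁻¹ * ∑ s : Fin n → Bool, c := by
        unfold rademacherAverage
        gcongr with s
        exact iSup₂_le (h s)
    _ = c := by
        simp only [Finset.sum_const, Finset.card_univ, Fintype.card_pi, Fintype.card_bool,
          Finset.prod_const, Fintype.card_fin, nsmul_eq_mul, Nat.cast_pow, Nat.cast_ofNat]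
        rw [← mul_assoc, ENNReal.inv_mul_cancel (by positivity) (by simp), one_mul]

/-- The bound by the Cauchy-Schwarz inequality, which ignores all cancellation. -/
lemma rademacherAverage_le_sqrt_mul {α : Type*} {n : ℕ} {A : Set (α → ℝ)} (z : Fin n → α) {σ : ℝ}
    (hσ : 0 ≤ σ) (hz : ∀ f ∈ A, ∑ j, f (z j) ^ 2 ≤ σ ^ 2) :
    rademacherAverage A z ≤ ENNReal.ofReal (√n * σ) := by
  refine rademacherAverage_le_of_forall fun s f hf => ?_
  rw [Real.enorm_eq_ofReal_abs]
  refine ENNReal.ofReal_le_ofReal (abs_le_of_sq_le_sq ?_ (by positivity : 0 ≤ √(n : ℝ) * σ))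
  rw [mul_pow, Real.sq_sqrt (by positivity)]
  refine (sq_sum_le_card_mul_sum_sq (s := Finset.univ)).trans ?_
  rw [Finset.card_univ, Fintype.card_fin]
  gcongr
  refine le_trans (le_of_eq (Finset.sum_congr rfl fun j _ => ?_)) (hz f hf)
  rw [mul_pow, ← sq_abs (sgn _), abs_sgn, one_pow, one_mul]

lemma rademacherAverage_mono {α : Type*} {n : ℕ} {A B : Set (α → ℝ)} (h : A ⊆ B)
    (z : Fin n → α) : rademacherAverage A z ≤ rademacherAverage B z := by
  unfold rademacherAverage
  gcongr with s _ f
  exact iSup_const_mono fun hf => h hf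

lemma rademacherAverage_le_add {α : Type*} {n : ℕ} {A B C : Set (α → ℝ)} (z : Fin n → α)
    (h : ∀ f ∈ A, ∃ g ∈ B, f - g ∈ C) :
    rademacherAverage A z ≤ rademacherAverage B z + rademacherAverage C z := by
  unfold rademacherAverage
  rw [← mul_add, ← Finset.sum_add_distrib]
  gcongr with s
  refine iSup₂_le fun f hf => ?_
  obtain ⟨g, hg, hfg⟩ := h f hf
  have e : ∑ j, sgn (s j) * f (z j) =
      ∑ j, sgn (s j) * g (z j) + ∑ j, sgn (s j) * (f - g) (z j) := by
    rw [← Finset.sum_add_distrib]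
    exact Finset.sum_congr rfl fun j _ => by simp; ring
  rw [e]
  refine (enorm_add_le _ _).trans (add_le_add ?_ ?_)
  · exact le_biSup (fun f : α → ℝ => ‖∑ j, sgn (s j) * f (z j)‖ₑ) hg
  · exact le_biSup (fun f : α → ℝ => ‖∑ j, sgn (s j) * f (z j)‖ₑ) hfg

/-! ### Covering numbers and the entropy integral -/

lemma coveringNumber_anti {d : ℕ} (F : Set (Euc d → ℝ)) (p : ℝ≥0∞) (Q : Measure (Euc d)) :
    Antitone fun η => coveringNumber η F p Q := by
  intro η η' h
  refine le_iInf fun C => le_iInf fun hC => le_iInf fun hcov => ?_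
  refine iInf_le_of_le C (iInf_le_of_le hC (iInf_le_of_le (fun f hf => ?_) le_rfl))
  obtain ⟨g, hg, hfg⟩ := hcov f hf
  exact ⟨g, hg, hfg.trans h⟩

lemma sqrtLog_mono : Monotone sqrtLog := by
  intro M N h
  unfold sqrtLog
  split_ifs with h1 h2 h2
  · exact le_rfl
  · exact absurd (top_le_iff.1 (h1 ▸ h)) h2
  · exact le_top
  · refine ENNReal.ofReal_le_ofReal (Real.sqrt_le_sqrt ?_)
    have hMN : M.toNat ≤ N.toNat := ENat.toNat_le_toNat h h2
    rcases Nat.eq_zero_or_pos M.toNat with h0 | h0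
    · simpa [h0] using Real.log_natCast_nonneg (2 * N.toNat)
    · have : (0 : ℝ) < M.toNat := by exact_mod_cast h0
      have : (M.toNat : ℝ) ≤ N.toNat := by exact_mod_cast hMN
      exact Real.log_le_log (by positivity) (by linarith)

/-- A finite value of `sqrtLog` at a covering number is attained by an actual finite cover. -/
lemma exists_finite_cover {d : ℕ} {F : Set (Euc d → ℝ)} (hF : F.Nonempty) {η p : ℝ≥0∞}
    {Q : Measure (Euc d)} (h : sqrtLog (coveringNumber η F p Q) ≠ ⊤) :
    ∃ C ⊆ F, C.Finite ∧ (∀ f ∈ F, ∃ g ∈ C, eLpNorm (f - g) p Q ≤ η) ∧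
      ∃ N : ℕ, 1 ≤ N ∧ C.ncard ≤ N ∧
        ENNReal.ofReal √(Real.log (2 * N)) = sqrtLog (coveringNumber η F p Q) := by
  have hne : coveringNumber η F p Q ≠ ⊤ := by
    intro h0
    simp [h0, sqrtLog] at h
  obtain ⟨N, hN⟩ := ENat.ne_top_iff_exists.1 hne
  have hlt : coveringNumber η F p Q < ((N + 1 : ℕ) : ℕ∞) := by
    rw [← hN]
    exact_mod_cast N.lt_succ_self
  unfold coveringNumber at hlt
  simp only [iInf_lt_iff] at hlt
  obtain ⟨C, hCF, hcov, hC⟩ := hlt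
  have hfin : C.Finite := Set.encard_lt_top_iff.1 (hC.trans (ENat.natCast_lt_top _))
  have hcard : C.ncard ≤ N := by
    rw [← hfin.cast_ncard_eq] at hC
    have : C.ncard < N + 1 := by exact_mod_cast hC
    omega
  obtain ⟨f, hf⟩ := hF
  obtain ⟨g, hg, -⟩ := hcov f hf
  have hpos : 0 < C.ncard := (Set.ncard_pos hfin).2 ⟨g, hg⟩
  refine ⟨C, hCF, hfin, hcov, N, by omega, hcard, ?_⟩
  rw [← hN]
  simp [sqrtLog]

/-- The integrand of the uniform entropy integral: the supremum over the finitely supported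
probability measures of the root of the logarithmic covering number at relative radius `ε`. -/
noncomputable def uniformEntropy {d : ℕ} (F : Set (Euc d → ℝ)) (C : Euc d → ℝ) (ε : ℝ) : ℝ≥0∞ :=
  ⨆ Q ∈ finSuppMeasures d, sqrtLog (coveringNumber (ENNReal.ofReal ε * eLpNorm C 2 Q) F 2 Q)

lemma uniformEntropy_anti {d : ℕ} (F : Set (Euc d → ℝ)) (C : Euc d → ℝ) :
    Antitone (uniformEntropy F C) := by
  intro ε ε' h
  refine iSup₂_mono fun Q _ => sqrtLog_mono (coveringNumber_anti F 2 Q ?_)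
  gcongr

/-- The lower dyadic Riemann sums of an antitone function are dominated by its integral. -/
lemma sum_dyadic_le_lintegral {g : ℝ → ℝ≥0∞} (hg : Antitone g) (K : ℕ) :
    ∑ k ∈ Finset.range K, ENNReal.ofReal (2⁻¹ ^ (k + 2)) * g (2⁻¹ ^ (k + 1)) ≤
      ∫⁻ ε in Set.Ioc 0 (1 / 2), g ε := by
  have key : ∑ k ∈ Finset.range K, ENNReal.ofReal (2⁻¹ ^ (k + 2)) * g (2⁻¹ ^ (k + 1)) ≤
      ∫⁻ ε in Set.Ioc (2⁻¹ ^ (K + 1)) (1 / 2), g ε := by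
    induction K with
    | zero => simp
    | succ K ih =>
      have h1 : (2⁻¹ : ℝ) ^ (K + 1 + 1) ≤ 2⁻¹ ^ (K + 1) :=
        pow_le_pow_of_le_one (by norm_num) (by norm_num) (by omega)
      have h2 : (2⁻¹ : ℝ) ^ (K + 1) ≤ 1 / 2 := by
        calc (2⁻¹ : ℝ) ^ (K + 1) ≤ 2⁻¹ ^ 1 :=
              pow_le_pow_of_le_one (by norm_num) (by norm_num) (by omega)
          _ = 1 / 2 := by norm_num
      rw [Finset.sum_range_succ, ← Set.Ioc_union_Ioc_eq_Ioc h1 h2,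
        lintegral_union measurableSet_Ioc (Set.Ioc_disjoint_Ioc_of_le le_rfl), add_comm]
      refine add_le_add ?_ ih
      have h3 : ENNReal.ofReal (2⁻¹ ^ (K + 2)) =
          volume (Set.Ioc ((2⁻¹ : ℝ) ^ (K + 1 + 1)) (2⁻¹ ^ (K + 1))) := by
        rw [Real.volume_Ioc]
        congr 1
        ring
      rw [h3, mul_comm, ← setLIntegral_const]
      exact setLIntegral_mono' measurableSet_Ioc fun x hx => hg hx.2
  refine key.trans (lintegral_mono_set (Set.Ioc_subset_Ioc_left (by positivity)))

/-! ### The empirical measure -/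

/-- The empirical measure of a sample. -/
noncomputable def empiricalMeasure {d n : ℕ} (z : Fin n → Euc d) : Measure (Euc d) :=
  (n : ℝ≥0∞)⁻¹ • ∑ j, Measure.dirac (z j)

lemma empiricalMeasure_mem_finSuppMeasures {d n : ℕ} (hn : 1 ≤ n) (z : Fin n → Euc d) :
    empiricalMeasure z ∈ finSuppMeasures d := by
  refine ⟨⟨?_⟩, Set.range z, Set.finite_range z, ?_⟩
  · simp only [empiricalMeasure, Measure.smul_apply, Measure.finsetSum_apply, measure_univ,
      Finset.sum_const, Finset.card_univ, Fintype.card_fin, smul_eq_mul, nsmul_eq_mul, mul_one]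
    exact ENNReal.inv_mul_cancel (by simp; omega) (by simp)
  · have hm : MeasurableSet (Set.range z)ᶜ := (Set.finite_range z).measurableSet.compl
    simp [empiricalMeasure, Measure.finsetSum_apply, Measure.dirac_apply' _ hm]

lemma eLpNorm_empiricalMeasure {d n : ℕ} (hn : 1 ≤ n) (z : Fin n → Euc d) (f : Euc d → ℝ) :
    eLpNorm f 2 (empiricalMeasure z) = ENNReal.ofReal (√(∑ j, f (z j) ^ 2) / √n) := by
  have hn' : (0 : ℝ) < n := by exact_mod_cast hn
  rw [eLpNorm_eq_lintegral_rpow_enorm_toReal (by norm_num) (by norm_num), empiricalMeasure,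
    lintegral_smul_measure, lintegral_finsetSum_measure]
  simp only [lintegral_dirac, ENNReal.toReal_ofNat, smul_eq_mul]
  have h : ∀ j, ‖f (z j)‖ₑ ^ (2 : ℝ) = ENNReal.ofReal (f (z j) ^ 2) := by
    intro j
    rw [Real.enorm_eq_ofReal_abs, ENNReal.ofReal_rpow_of_nonneg (abs_nonneg _) (by norm_num)]
    norm_num
  simp_rw [h]
  rw [← ENNReal.ofReal_sum_of_nonneg fun j _ => sq_nonneg _, ← ENNReal.ofReal_natCast,
    ← ENNReal.ofReal_inv_of_pos hn', ← ENNReal.ofReal_mul (by positivity),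
    ENNReal.ofReal_rpow_of_nonneg (by positivity) (by norm_num), ← Real.sqrt_eq_rpow,
    ← Real.sqrt_div' _ hn'.le]
  congr 2
  ring

lemma sum_sq_le_of_eLpNorm_le {d n : ℕ} (hn : 1 ≤ n) {z : Fin n → Euc d} {f ξ : Euc d → ℝ} {ε : ℝ}
    (hε : 0 ≤ ε) (h : eLpNorm f 2 (empiricalMeasure z) ≤
      ENNReal.ofReal ε * eLpNorm ξ 2 (empiricalMeasure z)) :
    ∑ j, f (z j) ^ 2 ≤ (ε * √(∑ j, ξ (z j) ^ 2)) ^ 2 := by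
  have hn' : (0 : ℝ) < n := by exact_mod_cast hn
  rw [eLpNorm_empiricalMeasure hn, eLpNorm_empiricalMeasure hn, ← ENNReal.ofReal_mul hε,
    ENNReal.ofReal_le_ofReal_iff (by positivity), ← mul_div_assoc,
    div_le_div_iff_of_pos_right (by positivity)] at h
  exact (Real.sqrt_le_left (by positivity)).1 h

/-! ### Chaining -/

/-- Dudley's entropy bound: conditionally on the sample, the Rademacher process has subgaussian
increments for the `L²` distance of the empirical measure, and chaining along minimal covers of
radii `2⁻¹ ^ (k + 1) * ‖ξ‖` sums up to the uniform entropy integral. -/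
theorem rademacherAverage_le_entropyIntegral {d n : ℕ} (hn : 1 ≤ n) {F : Set (Euc d → ℝ)}
    (hF : F.Nonempty) {ξ : Euc d → ℝ} (hξ : ∀ x, 0 < ξ x) (hFξ : ∀ f ∈ F, ∀ x, |f x| ≤ ξ x)
    (hJ : entropyIntegral F ξ (1 / 2) ≠ ⊤) (z : Fin n → Euc d) :
    rademacherAverage F z ≤
      ENNReal.ofReal (4 * √2 * √(∑ j, ξ (z j) ^ 2)) * entropyIntegral F ξ (1 / 2) := by
  have hanti := uniformEntropy_anti F ξ
  set u := uniformEntropy F ξ with hu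
  set S := √(∑ j, ξ (z j) ^ 2) with hS
  have hSpos : 0 < S := by
    have : Nonempty (Fin n) := ⟨⟨0, hn⟩⟩
    exact Real.sqrt_pos.2 (Finset.sum_pos (fun j _ => pow_pos (hξ _) 2) Finset.univ_nonempty)
  have hSsq : S ^ 2 = ∑ j, ξ (z j) ^ 2 := Real.sq_sqrt (Finset.sum_nonneg fun j _ => sq_nonneg _)
  have hJeq : entropyIntegral F ξ (1 / 2) = ∫⁻ ε in Set.Ioc 0 (1 / 2), u ε := rfl
  set Q := empiricalMeasure z with hQ
  have hQmem : Q ∈ finSuppMeasures d := empiricalMeasure_mem_finSuppMeasures hn z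
  have hufin : ∀ k : ℕ, u (2⁻¹ ^ (k + 1)) ≠ ⊤ := by
    intro k h
    have h1 := sum_dyadic_le_lintegral hanti (k + 1)
    rw [Finset.sum_range_succ, h, ENNReal.mul_top (by positivity), add_top, ← hJeq] at h1
    exact hJ (top_le_iff.1 h1)
  have hle : ∀ ε : ℝ, sqrtLog (coveringNumber (ENNReal.ofReal ε * eLpNorm ξ 2 Q) F 2 Q) ≤ u ε :=
    fun ε => le_biSup (fun Q => sqrtLog
      (coveringNumber (ENNReal.ofReal ε * eLpNorm ξ 2 Q) F 2 Q)) hQmem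
  choose C hCF hCfin hcov N hN hCN hNe using fun k : ℕ =>
    exists_finite_cover hF (ne_top_of_le_ne_top (hufin k) (hle (2⁻¹ ^ (k + 1))))
  have hNu : ∀ k, ENNReal.ofReal √(Real.log (2 * N k)) ≤ u (2⁻¹ ^ (k + 1)) :=
    fun k => (hNe k).trans_le (hle _)
  have hfin : ∀ (k : ℕ) (σ : ℝ), 0 < σ → ∀ A : Set (Euc d → ℝ), A.Finite → A.ncard ≤ N k →
      (∀ f ∈ A, ∑ j, f (z j) ^ 2 ≤ σ ^ 2) →
      rademacherAverage A z ≤ ENNReal.ofReal (√2 * σ) * u (2⁻¹ ^ (k + 1)) := by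
    intro k σ hσ A hA hAN hAz
    refine (rademacherAverage_le_of_finite hA z (hN k) hAN hσ hAz).trans ?_
    rw [Real.sqrt_mul (by norm_num), ← mul_assoc, mul_comm σ, ENNReal.ofReal_mul (by positivity)]
    gcongr
    exact hNu k
  have hchain : ∀ k, rademacherAverage (C k) z ≤ ENNReal.ofReal (4 * √2 * S) *
      ∑ i ∈ Finset.range (k + 1), ENNReal.ofReal (2⁻¹ ^ (i + 2)) * u (2⁻¹ ^ (i + 1)) := by
    intro k
    induction k with
    | zero =>
      rw [zero_add, Finset.sum_range_one, ← mul_assoc, ← ENNReal.ofReal_mul (by positivity)]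
      refine (hfin 0 S hSpos (C 0) (hCfin 0) (hCN 0) fun f hf => ?_).trans ?_
      · rw [hSsq]
        exact Finset.sum_le_sum fun j _ => sq_le_sq' (abs_le.1 (hFξ f (hCF 0 hf) _)).1
          (abs_le.1 (hFξ f (hCF 0 hf) _)).2
      · apply le_of_eq
        congr 2
        ring
    | succ k ih =>
      -- projecting the `(k + 1)`-st cover to the `k`-th one gives at most `N (k + 1)` links
      choose! π hπC hπ using hcov k
      rw [Finset.sum_range_succ, mul_add]
      refine (rademacherAverage_le_add (B := C k) (C := (fun f => f - π f) '' C (k + 1)) z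
        fun f hf => ⟨π f, hπC f (hCF _ hf), f, hf, rfl⟩).trans (add_le_add ih ?_)
      refine (hfin (k + 1) (2⁻¹ ^ (k + 1) * S) (by positivity) _ ((hCfin _).image _)
        ((Set.ncard_image_le (hCfin _)).trans (hCN _)) ?_).trans ?_
      · rintro _ ⟨f, hf, rfl⟩
        exact sum_sq_le_of_eLpNorm_le hn (by positivity) (hπ f (hCF _ hf))
      · rw [← mul_assoc (ENNReal.ofReal (4 * √2 * S)), ← ENNReal.ofReal_mul (by positivity)]
        apply le_of_eq
        congr 2
        ring
  -- the part of the class beyond the `k`-th cover is controlled without using cancellation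
  have hbound : ∀ k : ℕ, rademacherAverage F z ≤
      ENNReal.ofReal (4 * √2 * S) * entropyIntegral F ξ (1 / 2) +
        ENNReal.ofReal (√n * (2⁻¹ ^ (k + 1) * S)) := by
    intro k
    choose! π hπC hπ using hcov k
    refine (rademacherAverage_le_add (B := C k) (C := (fun f => f - π f) '' F) z
      fun f hf => ⟨π f, hπC f hf, f, hf, rfl⟩).trans (add_le_add ?_ ?_)
    · refine (hchain k).trans ?_
      gcongr
      exact sum_dyadic_le_lintegral hanti _
    · refine rademacherAverage_le_sqrt_mul z (by positivity) ?_
      rintro _ ⟨f, hf, rfl⟩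
      exact sum_sq_le_of_eLpNorm_le hn (by positivity) (hπ f hf)
  refine ge_of_tendsto' (x := Filter.atTop) ?_ hbound
  have hlim : Filter.Tendsto (fun k : ℕ => √(n : ℝ) * ((2⁻¹ : ℝ) ^ (k + 1) * S)) Filter.atTop
      (nhds (√(n : ℝ) * (0 * S))) :=
    (((tendsto_pow_atTop_nhds_zero_of_lt_one (by norm_num) (by norm_num)).comp
      (Filter.tendsto_add_atTop_nat 1)).mul_const S).const_mul _
  have hlim' := (ENNReal.continuous_ofReal.tendsto _).comp hlim
  simpa using hlim'.const_add (ENNReal.ofReal (4 * √2 * S) * entropyIntegral F ξ (1 / 2))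

/-! ### Symmetrization -/

lemma measurable_biSup_enorm {α β : Type*} [MeasurableSpace β] {A : Set (α → ℝ)} (hA : A.Countable)
    {φ : (α → ℝ) → β → ℝ} (hφ : ∀ f ∈ A, Measurable (φ f)) :
    Measurable fun b => ⨆ f ∈ A, ‖φ f b‖ₑ :=
  Measurable.biSup A hA fun f hf => (hφ f hf).enorm

section Symmetrization

variable {α : Type*} [MeasurableSpace α] {n : ℕ}

/-- Exchanging the `j`-th points of two independent samples for all `j` with `s j = false`
preserves their joint law. -/
lemma measurePreserving_swapCoordinates (μ : Measure α) [IsProbabilityMeasure μ]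
    (s : Fin n → Bool) :
    MeasurePreserving (fun p : (Fin n → α) × (Fin n → α) =>
      ((fun j => if s j then p.1 j else p.2 j, fun j => if s j then p.2 j else p.1 j) :
        (Fin n → α) × (Fin n → α)))
      ((Measure.pi fun _ => μ).prod (Measure.pi fun _ => μ))
      ((Measure.pi fun _ => μ).prod (Measure.pi fun _ => μ)) := by
  have he := measurePreserving_arrowProdEquivProdArrow α α (Fin n) (fun _ => μ) (fun _ => μ)
  have hs : MeasurePreserving
      (fun (q : Fin n → α × α) j => (if s j then id else Prod.swap) (q j))
      (Measure.pi fun _ => μ.prod μ) (Measure.pi fun _ => μ.prod μ) := by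
    refine measurePreserving_pi _ _ fun j => ?_
    split_ifs
    · exact MeasurePreserving.id _
    · exact Measure.measurePreserving_swap
  have h := (he.comp hs).comp (he.symm _)
  convert h using 1
  funext p
  refine Prod.ext (funext fun j => ?_) (funext fun j => ?_) <;>
  · by_cases hj : s j = true <;>
      simp [hj, MeasurableEquiv.arrowProdEquivProdArrow, Equiv.arrowProdEquivProdArrow]

lemma measurable_signedSum {f : α → ℝ} (hf : Measurable f) (c : Fin n → ℝ) :
    Measurable fun z : Fin n → α => ∑ j, c j * f (z j) := by
  fun_prop

lemma lintegral_rademacherAverage (ν : Measure (Fin n → α)) {A : Set (α → ℝ)} (hA : A.Countable)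
    (hm : ∀ f ∈ A, Measurable f) :
    ∫⁻ z, rademacherAverage A z ∂ν =
      (2 ^ n)⁻¹ * ∑ s : Fin n → Bool, ∫⁻ z, ⨆ f ∈ A, ‖∑ j, sgn (s j) * f (z j)‖ₑ ∂ν := by
  have h : ∀ s : Fin n → Bool, Measurable fun z : Fin n → α =>
      ⨆ f ∈ A, ‖∑ j, sgn (s j) * f (z j)‖ₑ :=
    fun s => measurable_biSup_enorm hA fun f hf => measurable_signedSum (hm f hf) _
  unfold rademacherAverage
  rw [lintegral_const_mul _ (Finset.measurable_fun_sum _ fun s _ => h s),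
    lintegral_finsetSum _ fun s _ => h s]

/-- Symmetrization: the expected supremum of a centered empirical process is at most twice the
expected Rademacher average of the class. The means are integrals over an independent copy of the
sample, and exchanging points of the two samples inserts arbitrary signs. -/
theorem lintegral_biSup_centered_le (μ : Measure α) [IsProbabilityMeasure μ]
    {A : Set (α → ℝ)} (hA : A.Countable) (hm : ∀ f ∈ A, Measurable f)
    (hi : ∀ f ∈ A, Integrable f μ) :
    ∫⁻ z : Fin n → α, ⨆ f ∈ A, ‖∑ j, (f (z j) - ∫ x, f x ∂μ)‖ₑ ∂(Measure.pi fun _ => μ) ≤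
      2 * ∫⁻ z : Fin n → α, rademacherAverage A z ∂(Measure.pi fun _ => μ) := by
  set ν : Measure (Fin n → α) := Measure.pi fun _ => μ with hν
  set R : (Fin n → Bool) → (Fin n → α) → ℝ≥0∞ :=
    fun s z => ⨆ f ∈ A, ‖∑ j, sgn (s j) * f (z j)‖ₑ with hR
  have hRm : ∀ s, Measurable (R s) :=
    fun s => measurable_biSup_enorm hA fun f hf => measurable_signedSum (hm f hf) _
  set D : (Fin n → α) × (Fin n → α) → ℝ≥0∞ :=
    fun p => ⨆ f ∈ A, ‖∑ j, (f (p.1 j) - f (p.2 j))‖ₑ with hD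
  have hDm : Measurable D := measurable_biSup_enorm hA fun f hf => by
    have := hm f hf
    fun_prop
  have hcopy : ∀ f ∈ A, ∀ z : Fin n → α,
      ∑ j, (f (z j) - ∫ x, f x ∂μ) = ∫ w : Fin n → α, ∑ j, (f (z j) - f (w j)) ∂ν := by
    intro f hf z
    have hint : ∀ j : Fin n, Integrable (fun w : Fin n → α => f (w j)) ν := fun j =>
      (measurePreserving_eval (fun _ : Fin n => μ) j).integrable_comp_of_integrable (hi f hf)
    rw [integral_finsetSum _ fun j _ => (integrable_const (f (z j))).sub' (hint j)]
    refine Finset.sum_congr rfl fun j _ => ?_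
    rw [integral_sub (integrable_const _) (hint j)]
    have h := (measurePreserving_eval (fun _ : Fin n => μ) j).map_eq
    have h2 : ∫ x, f x ∂μ = ∫ w : Fin n → α, f (w j) ∂ν := by
      conv_lhs => rw [← h]
      rw [integral_map (measurable_pi_apply j).aemeasurable
        (hm f hf).aestronglyMeasurable]
    simp [h2]
  have hLD : ∫⁻ z, ⨆ f ∈ A, ‖∑ j, (f (z j) - ∫ x, f x ∂μ)‖ₑ ∂ν ≤ ∫⁻ p, D p ∂(ν.prod ν) := by
    rw [lintegral_prod _ hDm.aemeasurable]
    refine lintegral_mono fun z => iSup₂_le fun f hf => ?_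
    rw [hcopy f hf z]
    refine (enorm_integral_le_lintegral_enorm _).trans (lintegral_mono fun w => ?_)
    exact le_biSup (fun f : α → ℝ => ‖∑ j, (f (z j) - f (w j))‖ₑ) hf
  have hDR : ∀ s, ∫⁻ p, D p ∂(ν.prod ν) ≤ 2 * ∫⁻ z, R s z ∂ν := by
    intro s
    rw [← (measurePreserving_swapCoordinates μ s).lintegral_comp hDm]
    calc _ ≤ ∫⁻ p : (Fin n → α) × (Fin n → α), (R s p.1 + R s p.2) ∂(ν.prod ν) := by
          refine lintegral_mono fun p => iSup₂_le fun f hf => ?_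
          have e : ∑ j, (f (if s j then p.1 j else p.2 j) - f (if s j then p.2 j else p.1 j)) =
              ∑ j, sgn (s j) * f (p.1 j) - ∑ j, sgn (s j) * f (p.2 j) := by
            rw [← Finset.sum_sub_distrib]
            refine Finset.sum_congr rfl fun j _ => ?_
            by_cases hj : s j = true
            · simp [hj, sgn]
            · simp [hj, sgn, neg_add_eq_sub]
          rw [e]
          refine enorm_sub_le.trans (add_le_add ?_ ?_)
          · exact le_biSup (fun f : α → ℝ => ‖∑ j, sgn (s j) * f (p.1 j)‖ₑ) hf
          · exact le_biSup (fun f : α → ℝ => ‖∑ j, sgn (s j) * f (p.2 j)‖ₑ) hf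
      _ = 2 * ∫⁻ z, R s z ∂ν := by
          rw [lintegral_add_left (f := fun p : (Fin n → α) × (Fin n → α) => R s p.1)
            ((hRm s).comp measurable_fst),
            measurePreserving_fst.lintegral_comp (hRm s),
            measurePreserving_snd.lintegral_comp (hRm s), two_mul]
  rw [lintegral_rademacherAverage ν hA hm]
  set L := ∫⁻ z, ⨆ f ∈ A, ‖∑ j, (f (z j) - ∫ x, f x ∂μ)‖ₑ ∂ν with hL
  calc L = (2 ^ n)⁻¹ * ∑ s : Fin n → Bool, L := by
        simp only [Finset.sum_const, Finset.card_univ, Fintype.card_pi, Fintype.card_bool,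
          Finset.prod_const, Fintype.card_fin, nsmul_eq_mul, Nat.cast_pow, Nat.cast_ofNat]
        rw [← mul_assoc, ENNReal.inv_mul_cancel (by positivity) (by simp), one_mul]
    _ ≤ (2 ^ n)⁻¹ * ∑ s : Fin n → Bool, 2 * ∫⁻ z, R s z ∂ν := by
        gcongr with s
        exact hLD.trans (hDR s)
    _ = _ := by
        rw [← Finset.mul_sum, mul_left_comm]

end Symmetrization

/-! ### The maximal inequality for the empirical process -/

lemma lintegral_sqrt_sum_sq_le {α : Type*} [MeasurableSpace α] {n : ℕ} (hn : 1 ≤ n)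
    (μ : Measure α) [IsProbabilityMeasure μ] {ξ : α → ℝ} (hξ : MemLp ξ 2 μ) :
    ∫⁻ z : Fin n → α, ENNReal.ofReal √(∑ j, ξ (z j) ^ 2) ∂(Measure.pi fun _ => μ) ≤
      ENNReal.ofReal (√n * (∫ x, ξ x ^ 2 ∂μ + 1)) := by
  have hn' : (0 : ℝ) < n := by exact_mod_cast hn
  have hsq : Integrable (fun x => ξ x ^ 2) μ := hξ.integrable_sq
  have hint : ∀ j : Fin n, Integrable (fun z : Fin n → α => ξ (z j) ^ 2)
      (Measure.pi fun _ => μ) := fun j =>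
    (measurePreserving_eval (fun _ : Fin n => μ) j).integrable_comp_of_integrable hsq
  have hval : ∀ j : Fin n, ∫ z : Fin n → α, ξ (z j) ^ 2 ∂(Measure.pi fun _ => μ) =
      ∫ x, ξ x ^ 2 ∂μ := by
    intro j
    have h := (measurePreserving_eval (fun _ : Fin n => μ) j).map_eq
    conv_rhs => rw [← h]
    rw [integral_map (measurable_pi_apply j).aemeasurable]
    rw [h]
    exact hsq.aestronglyMeasurable
  have hsum : Integrable (fun z : Fin n → α => (∑ j, ξ (z j) ^ 2) / √n + √n)
      (Measure.pi fun _ => μ) :=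
    ((integrable_finsetSum _ fun j _ => hint j).div_const _).add (integrable_const _)
  calc _ ≤ ∫⁻ z : Fin n → α, ENNReal.ofReal ((∑ j, ξ (z j) ^ 2) / √n + √n)
        ∂(Measure.pi fun _ => μ) := by
        -- by the inequality of arithmetic and geometric means, with weight `√n`
        refine lintegral_mono fun z => ENNReal.ofReal_le_ofReal ?_
        have hT : 0 ≤ ∑ j, ξ (z j) ^ 2 := Finset.sum_nonneg fun j _ => sq_nonneg _
        have hs : 0 < √(n : ℝ) := Real.sqrt_pos.2 hn'
        rw [← sub_le_iff_le_add, le_div_iff₀ hs]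
        nlinarith [Real.sq_sqrt hT, sq_nonneg (√(∑ j, ξ (z j) ^ 2) - √n),
          Real.sqrt_nonneg (∑ j, ξ (z j) ^ 2)]
    _ = ENNReal.ofReal (∫ z : Fin n → α, ((∑ j, ξ (z j) ^ 2) / √n + √n)
        ∂(Measure.pi fun _ => μ)) := by
        rw [ofReal_integral_eq_lintegral_ofReal hsum]
        exact Filter.Eventually.of_forall fun z => by positivity
    _ = _ := by
        congr 1
        rw [integral_add ((integrable_finsetSum _ fun j _ => hint j).div_const _)
          (integrable_const _), integral_div, integral_finsetSum _ fun j _ => hint j]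
        simp only [hval, Finset.sum_const, Finset.card_univ, Fintype.card_fin, nsmul_eq_mul,
          integral_const, probReal_univ, one_smul]
        rw [mul_div_right_comm, Real.div_sqrt]
        ring

/-- For a countable subclass of a class with finite uniform entropy integral, the expected supremum
of the centered sums grows at most like `√n`. -/
theorem lintegral_biSup_centered_le_entropyIntegral {d n : ℕ} (hn : 1 ≤ n)
    (μ : Measure (Euc d)) [IsProbabilityMeasure μ] {A F : Set (Euc d → ℝ)} (hA : A.Countable)
    (hAF : A ⊆ F) (hF : F.Nonempty) (hm : ∀ f ∈ A, Measurable f) {ξ : Euc d → ℝ}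
    (hξ : ∀ x, 0 < ξ x) (hξ2 : MemLp ξ 2 μ) (hFξ : ∀ f ∈ F, ∀ x, |f x| ≤ ξ x)
    (hJ : entropyIntegral F ξ (1 / 2) ≠ ⊤) :
    ∫⁻ z : Fin n → Euc d, ⨆ f ∈ A, ‖∑ j, (f (z j) - ∫ x, f x ∂μ)‖ₑ ∂(Measure.pi fun _ => μ) ≤
      ENNReal.ofReal √n * (ENNReal.ofReal (8 * √2 * (∫ x, ξ x ^ 2 ∂μ + 1)) *
        entropyIntegral F ξ (1 / 2)) := by
  have hi : ∀ f ∈ A, Integrable f μ := fun f hf =>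
    (hξ2.integrable (by norm_num)).mono' (hm f hf).aestronglyMeasurable
      (Filter.Eventually.of_forall (hFξ f (hAF hf)))
  have hV : 0 ≤ ∫ x, ξ x ^ 2 ∂μ := integral_nonneg fun x => sq_nonneg _
  set J := entropyIntegral F ξ (1 / 2) with hJdef
  calc _ ≤ 2 * ∫⁻ z : Fin n → Euc d, rademacherAverage A z ∂(Measure.pi fun _ => μ) :=
        lintegral_biSup_centered_le μ hA hm hi
    _ ≤ 2 * ∫⁻ z : Fin n → Euc d, (ENNReal.ofReal (4 * √2) * J) *
          ENNReal.ofReal √(∑ j, ξ (z j) ^ 2) ∂(Measure.pi fun _ => μ) := by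
        gcongr with z
        refine (rademacherAverage_mono hAF z).trans
          ((rademacherAverage_le_entropyIntegral hn hF hξ hFξ hJ z).trans_eq ?_)
        rw [ENNReal.ofReal_mul (by positivity)]
        ring
    _ = 2 * ((ENNReal.ofReal (4 * √2) * J) * ∫⁻ z : Fin n → Euc d,
          ENNReal.ofReal √(∑ j, ξ (z j) ^ 2) ∂(Measure.pi fun _ => μ)) := by
        rw [lintegral_const_mul' _ _ (ENNReal.mul_ne_top ENNReal.ofReal_ne_top hJ)]
    _ ≤ 2 * ((ENNReal.ofReal (4 * √2) * J) *
          ENNReal.ofReal (√n * (∫ x, ξ x ^ 2 ∂μ + 1))) := by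
        gcongr
        exact lintegral_sqrt_sum_sq_le hn μ hξ2
    _ = _ := by
        rw [ENNReal.ofReal_mul (Real.sqrt_nonneg _), ENNReal.ofReal_mul (p := 8 * √2)
          (by positivity), show (8 : ℝ) * √2 = 2 * (4 * √2) by ring,
          ENNReal.ofReal_mul (p := 2) (by norm_num), ENNReal.ofReal_ofNat]
        ring

/-! ### Optimal values over a countable set of parameters -/

lemma iInf_eq_iInf_of_approx {E : Type*} {Θ Θ₀ : Set E} (hsub : Θ₀ ⊆ Θ) (hne : Θ₀.Nonempty)
    {φ : E → ℝ} {b : ℝ} (hb : ∀ θ ∈ Θ, b ≤ φ θ)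
    (happ : ∀ θ ∈ Θ, ∀ ε > 0, ∃ ϑ ∈ Θ₀, φ ϑ ≤ φ θ + ε) :
    ⨅ θ : Θ, φ θ = ⨅ θ : Θ₀, φ θ := by
  have : Nonempty Θ₀ := hne.to_subtype
  have : Nonempty Θ := (hne.mono hsub).to_subtype
  have hbdd : BddBelow (Set.range fun θ : Θ => φ θ) := ⟨b, by rintro _ ⟨θ, rfl⟩; exact hb _ θ.2⟩
  have hbdd₀ : BddBelow (Set.range fun θ : Θ₀ => φ θ) :=
    ⟨b, by rintro _ ⟨θ, rfl⟩; exact hb _ (hsub θ.2)⟩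
  refine le_antisymm (le_ciInf fun θ => ciInf_le hbdd ⟨θ, hsub θ.2⟩) (le_ciInf fun θ => ?_)
  refine le_of_forall_pos_le_add fun ε hε => ?_
  obtain ⟨ϑ, hϑ, h⟩ := happ θ θ.2 ε hε
  exact (ciInf_le hbdd₀ ⟨ϑ, hϑ⟩).trans h

lemma enorm_iInf_sub_iInf_le {ι : Type*} [Nonempty ι] {φ ψ : ι → ℝ} {c : ℝ≥0∞}
    (hφ : BddBelow (Set.range φ)) (hψ : BddBelow (Set.range ψ)) (h : ∀ i, ‖φ i - ψ i‖ₑ ≤ c) :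
    ‖(⨅ i, φ i) - ⨅ i, ψ i‖ₑ ≤ c := by
  rcases eq_or_ne c ⊤ with rfl | hc
  · exact le_top
  have habs : ∀ x : ℝ, ‖x‖ₑ ≤ c ↔ |x| ≤ c.toReal := by
    intro x
    rw [Real.enorm_eq_ofReal_abs, ENNReal.ofReal_le_iff_le_toReal hc]
  simp_rw [habs] at h ⊢
  rw [abs_le]
  constructor
  · have : (⨅ i, ψ i) - c.toReal ≤ ⨅ i, φ i := le_ciInf fun i => by
      linarith [ciInf_le hψ i, (abs_le.1 (h i)).1]
    linarith
  · have : (⨅ i, φ i) - c.toReal ≤ ⨅ i, ψ i := le_ciInf fun i => by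
      linarith [ciInf_le hφ i, (abs_le.1 (h i)).2]
    linarith

section Reduction

variable {m d : ℕ} {Θ Θ₀ : Set (Euc m)} {G : Euc m → Euc d → ℝ} {PZ : Measure (Euc d)}
  {ξ : Euc d → ℝ}

lemma neg_integral_le_integral (hA2 : IntegrablePositiveEnvelope Θ G PZ ξ) {θ : Euc m}
    (hθ : θ ∈ Θ) : -∫ x, ξ x ∂PZ ≤ ∫ x, G θ x ∂PZ := by
  have h := norm_integral_le_of_norm_le (f := G θ) hA2.2.2.1
    (Filter.Eventually.of_forall fun x => hA2.2.2.2 x θ hθ)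
  exact (abs_le.1 h).1

lemma neg_mean_le_mean (hA2 : IntegrablePositiveEnvelope Θ G PZ ξ) {n : ℕ} (z : Fin n → Euc d)
    {θ : Euc m} (hθ : θ ∈ Θ) :
    -((1 / (n : ℝ)) * ∑ j, ξ (z j)) ≤ (1 / (n : ℝ)) * ∑ j, G θ (z j) := by
  rw [← mul_neg, ← Finset.sum_neg_distrib]
  gcongr with j
  exact (abs_le.1 (hA2.2.2.2 (z j) θ hθ)).1

lemma optValue_eq_iInf (hsub : Θ₀ ⊆ Θ) (hne : Θ₀.Nonempty)
    (hA2 : IntegrablePositiveEnvelope Θ G PZ ξ)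
    (h : ∀ θ ∈ Θ, (⨅ ϑ ∈ Θ₀, edist (∫ x, G ϑ x ∂PZ) (∫ x, G θ x ∂PZ)) = 0) :
    optValue Θ G PZ = ⨅ θ : Θ₀, ∫ x, G θ x ∂PZ := by
  refine iInf_eq_iInf_of_approx (φ := fun θ => ∫ x, G θ x ∂PZ) hsub hne
    (fun θ hθ => neg_integral_le_integral hA2 hθ) fun θ hθ ε hε => ?_
  have hlt : (⨅ ϑ ∈ Θ₀, edist (∫ x, G ϑ x ∂PZ) (∫ x, G θ x ∂PZ)) < ENNReal.ofReal ε := by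
    rw [h θ hθ]
    exact ENNReal.ofReal_pos.2 hε
  simp only [iInf_lt_iff] at hlt
  obtain ⟨ϑ, hϑ, hd⟩ := hlt
  rw [edist_lt_ofReal, Real.dist_eq] at hd
  exact ⟨ϑ, hϑ, by linarith [(abs_lt.1 hd).2]⟩

lemma iInf_mean_eq_iInf (hsub : Θ₀ ⊆ Θ) (hne : Θ₀.Nonempty)
    (hA2 : IntegrablePositiveEnvelope Θ G PZ ξ) {n : ℕ} (hn : 1 ≤ n) (z : Fin n → Euc d)
    (h : ∀ θ ∈ Θ, (⨅ ϑ ∈ Θ₀, ⨆ j : Fin n, edist (G θ (z j)) (G ϑ (z j))) = 0) :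
    ⨅ θ : Θ, (1 / (n : ℝ)) * ∑ j, G θ (z j) = ⨅ θ : Θ₀, (1 / (n : ℝ)) * ∑ j, G θ (z j) := by
  refine iInf_eq_iInf_of_approx (φ := fun θ => (1 / (n : ℝ)) * ∑ j, G θ (z j)) hsub hne
    (fun θ hθ => neg_mean_le_mean hA2 z hθ) fun θ hθ ε hε => ?_
  have hn' : (0 : ℝ) < n := by exact_mod_cast hn
  have hlt : (⨅ ϑ ∈ Θ₀, ⨆ j : Fin n, edist (G θ (z j)) (G ϑ (z j))) < ENNReal.ofReal ε := by
    rw [h θ hθ]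
    exact ENNReal.ofReal_pos.2 hε
  simp only [iInf_lt_iff] at hlt
  obtain ⟨ϑ, hϑ, hd⟩ := hlt
  refine ⟨ϑ, hϑ, ?_⟩
  have hj : ∀ j, G ϑ (z j) ≤ G θ (z j) + ε := by
    intro j
    have hdj := (le_iSup (fun j => edist (G θ (z j)) (G ϑ (z j))) j).trans_lt hd
    rw [edist_lt_ofReal, Real.dist_eq] at hdj
    linarith [(abs_lt.1 hdj).1]
  calc (1 / (n : ℝ)) * ∑ j, G ϑ (z j) ≤ (1 / (n : ℝ)) * ∑ j, (G θ (z j) + ε) := by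
        gcongr with j
        exact hj j
    _ = (1 / (n : ℝ)) * ∑ j, G θ (z j) + ε := by
        rw [Finset.sum_add_distrib, Finset.sum_const, Finset.card_univ, Fintype.card_fin,
          nsmul_eq_mul]
        field_simp

/-- The scaled difference of the two optimal values over `Θ₀` is at most the supremum over `Θ₀` of
the empirical process. -/
lemma enorm_sqrt_mul_iInf_sub_iInf_le (hsub : Θ₀ ⊆ Θ) (hne : Θ₀.Nonempty)
    (hA2 : IntegrablePositiveEnvelope Θ G PZ ξ) {n : ℕ} (hn : 1 ≤ n) (z : Fin n → Euc d) :
    ‖√n * ((⨅ θ : Θ₀, (1 / (n : ℝ)) * ∑ j, G θ (z j)) - ⨅ θ : Θ₀, ∫ x, G θ x ∂PZ)‖ₑ ≤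
      (ENNReal.ofReal √n)⁻¹ * ⨆ f ∈ G '' Θ₀, ‖∑ j, (f (z j) - ∫ x, f x ∂PZ)‖ₑ := by
  have hn' : (0 : ℝ) < n := by exact_mod_cast hn
  have hs : 0 < √(n : ℝ) := Real.sqrt_pos.2 hn'
  have : Nonempty Θ₀ := hne.to_subtype
  rw [mul_sub,
    Real.mul_iInf_of_nonneg hs.le, Real.mul_iInf_of_nonneg hs.le]
  refine enorm_iInf_sub_iInf_le ?_ ?_ fun θ => ?_
  · refine ⟨√n * -((1 / (n : ℝ)) * ∑ j, ξ (z j)), ?_⟩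
    rintro _ ⟨θ, rfl⟩
    exact mul_le_mul_of_nonneg_left (neg_mean_le_mean hA2 z (hsub θ.2)) hs.le
  · refine ⟨√n * -∫ x, ξ x ∂PZ, ?_⟩
    rintro _ ⟨θ, rfl⟩
    exact mul_le_mul_of_nonneg_left (neg_integral_le_integral hA2 (hsub θ.2)) hs.le
  · have e : √n * ((1 / (n : ℝ)) * ∑ j, G θ (z j)) - √n * ∫ x, G θ x ∂PZ =
        (√n)⁻¹ * ∑ j, (G θ (z j) - ∫ x, G θ x ∂PZ) := by
      rw [Finset.sum_sub_distrib, Finset.sum_const, Finset.card_univ, Fintype.card_fin,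
        nsmul_eq_mul]
      have h2 : √(n : ℝ) * √n = n := Real.mul_self_sqrt hn'.le
      field_simp
      rw [Real.sq_sqrt hn'.le]
    rw [e, enorm_mul]
    refine mul_le_mul' ?_ ?_
    · rw [Real.enorm_eq_ofReal_abs, abs_of_pos (inv_pos.2 hs), ENNReal.ofReal_inv_of_pos hs]
    · exact le_biSup (fun f : Euc d → ℝ => ‖∑ j, (f (z j) - ∫ x, f x ∂PZ)‖ₑ)
        (Set.mem_image_of_mem G θ.2)

end Reduction

/-! ### Tightness -/

/-- A family of real random variables that is bounded in `L¹` is tight, by Markov's inequality. -/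
lemma isTightMeasureSet_of_lintegral_enorm_le {Ω : Type*} [MeasurableSpace Ω] {P : Measure Ω}
    {W : ℕ → Ω → ℝ} {I : Set ℕ} (hW : ∀ n ∈ I, Measurable (W n)) {K : ℝ≥0∞} (hK : K ≠ ⊤)
    (h : ∀ n ∈ I, ∫⁻ ω, ‖W n ω‖ₑ ∂P ≤ K) :
    IsTightMeasureSet ((fun n => P.map (W n)) '' I) := by
  rw [isTightMeasureSet_iff_exists_isCompact_measure_compl_le]
  intro ε hε
  set r : ℝ := (K / ε).toReal + 1 with hr
  have hKε : K / ε ≠ ⊤ := ENNReal.div_ne_top hK hε.ne'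
  have hrpos : 0 < r := by positivity
  refine ⟨Metric.closedBall 0 r, isCompact_closedBall 0 r, ?_⟩
  rintro _ ⟨n, hn, rfl⟩
  simp only
  rw [Measure.map_apply (hW n hn) Metric.isClosed_closedBall.measurableSet.compl]
  calc P (W n ⁻¹' (Metric.closedBall 0 r)ᶜ) ≤ P {ω | ENNReal.ofReal r ≤ ‖W n ω‖ₑ} := by
        refine measure_mono fun ω hω => ?_
        simp only [Set.mem_preimage, Set.mem_compl_iff, mem_closedBall_zero_iff, not_le,
          Real.norm_eq_abs] at hω
        rw [Set.mem_ofPred_eq, Real.enorm_eq_ofReal_abs]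
        exact ENNReal.ofReal_le_ofReal hω.le
    _ ≤ (∫⁻ ω, ‖W n ω‖ₑ ∂P) / ENNReal.ofReal r :=
        meas_ge_le_lintegral_div (hW n hn).enorm.aemeasurable
          (ENNReal.ofReal_pos.2 hrpos).ne' ENNReal.ofReal_ne_top
    _ ≤ K / ENNReal.ofReal r := by
        gcongr
        exact h n hn
    _ ≤ ε := by
        refine ENNReal.div_le_of_le_mul ?_
        rcases eq_or_ne ε ⊤ with rfl | hε'
        · rw [ENNReal.top_mul (ENNReal.ofReal_pos.2 hrpos).ne']
          exact le_top
        · rw [← ENNReal.div_le_iff' hε.ne' hε', ENNReal.le_ofReal_iff_toReal_le hKε hrpos.le]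
          linarith

end SAA

theorem mainTheorem5 {m d : ℕ} {Ω : Type*} [MeasurableSpace Ω]
    (P : Measure Ω) [IsProbabilityMeasure P] [P.IsComplete]
    (PZ : Measure (SAA.Euc d)) [IsProbabilityMeasure PZ]
    (Z : ℕ → Ω → SAA.Euc d) (hZ_meas : ∀ j, Measurable (Z j))
    (hZ_law : ∀ j, P.map (Z j) = PZ) (hZ_indep : iIndepFun Z P)
    (Θ : Set (SAA.Euc m)) (hΘ_compact : IsCompact Θ) (hΘ_nonempty : Θ.Nonempty)
    (G : SAA.Euc m → SAA.Euc d → ℝ) (ξ : SAA.Euc d → ℝ)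
    (hA1 : SAA.MeasurableObjective Θ G)
    (hA2 : SAA.IntegrablePositiveEnvelope Θ G PZ ξ)
    (hA3 : SAA.CountablyDetermined Θ G PZ)
    (hξ : MemLp ξ 2 PZ)
    (hJ : SAA.entropyIntegral (SAA.objectiveClass Θ G) ξ (1 / 2) < ⊤) :
    (∀ n : ℕ, 1 ≤ n → Measurable (SAA.scaledError Θ G PZ Z n)) ∧
      IsTightMeasureSet ((fun n : ℕ => P.map (SAA.scaledError Θ G PZ Z n)) '' Set.Ici 1) := by
  obtain ⟨Θ₀, hsub, hcount, N, hN, hdet⟩ := hA3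
  have hνN : ∀ n, 1 ≤ n → ∀ᵐ z ∂(Measure.pi fun _ : Fin n => PZ), z ∉ N n :=
    fun n hn => measure_eq_zero_iff_ae_notMem.1 (hN n hn)
  obtain ⟨z₁, hz₁⟩ := (hνN 1 le_rfl).exists
  have hE : ∀ θ ∈ Θ, (⨅ ϑ ∈ Θ₀, edist (∫ x, G ϑ x ∂PZ) (∫ x, G θ x ∂PZ)) = 0 :=
    fun θ hθ => (hdet 1 le_rfl θ hθ z₁ hz₁).1
  have hne : Θ₀.Nonempty := by
    by_contra h
    obtain ⟨θ, hθ⟩ := hΘ_nonempty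
    simpa [Set.not_nonempty_iff_eq_empty.1 h] using hE θ hθ
  have : Countable Θ₀ := hcount.to_subtype
  set Y : (n : ℕ) → Ω → Fin n → SAA.Euc d := fun n ω j => Z j ω with hY
  have hYm : ∀ n, Measurable (Y n) := fun n => measurable_pi_lambda _ fun j => hZ_meas j
  have hYlaw : ∀ n, P.map (Y n) = Measure.pi fun _ : Fin n => PZ := by
    intro n
    have h := (iIndepFun_iff_map_fun_eq_pi_map (f := fun (j : Fin n) ω => Z j ω)
      fun j => (hZ_meas j).aemeasurable).1 (hZ_indep.precomp Fin.val_injective)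
    simpa only [hZ_law] using h
  set W : ℕ → Ω → ℝ := fun n ω => √n *
    ((⨅ θ : Θ₀, (1 / (n : ℝ)) * ∑ j, G θ (Y n ω j)) - ⨅ θ : Θ₀, ∫ x, G θ x ∂PZ) with hW
  have hWm : ∀ n, Measurable (W n) := by
    intro n
    refine measurable_const.mul ((Measurable.iInf fun θ => measurable_const.mul
      (Finset.measurable_fun_sum _ fun j _ => ?_)).sub measurable_const)
    exact (hA1 θ (hsub θ.2)).comp (hZ_meas j)
  have hae : ∀ n, 1 ≤ n → SAA.scaledError Θ G PZ Z n =ᵐ[P] W n := by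
    intro n hn
    have h : ∀ᵐ ω ∂P, Y n ω ∉ N n :=
      ae_of_ae_map (hYm n).aemeasurable ((hYlaw n).symm ▸ hνN n hn)
    filter_upwards [h] with ω hω
    have h1 : SAA.sampleOptValue Θ G Z n ω = ⨅ θ : Θ, (1 / (n : ℝ)) * ∑ j, G θ (Y n ω j) := by
      unfold SAA.sampleOptValue
      simp_rw [Finset.sum_range]
      rfl
    unfold SAA.scaledError
    rw [h1, SAA.iInf_mean_eq_iInf hsub hne hA2 hn _ fun θ hθ => (hdet n hn θ hθ _ hω).2,
      SAA.optValue_eq_iInf hsub hne hA2 hE]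
  have hmeas : ∀ n : ℕ, 1 ≤ n → Measurable (SAA.scaledError Θ G PZ Z n) := fun n hn =>
    aemeasurable_iff_measurable.1 ((hWm n).aemeasurable.congr (hae n hn).symm)
  refine ⟨hmeas, SAA.isTightMeasureSet_of_lintegral_enorm_le hmeas
    (ENNReal.mul_ne_top (ENNReal.ofReal_ne_top (r := 8 * √2 * (∫ x, ξ x ^ 2 ∂PZ + 1))) hJ.ne)
    fun n hn => ?_⟩
  have hn' : (0 : ℝ) < n := by exact_mod_cast hn
  have hs : ENNReal.ofReal √n ≠ 0 := (ENNReal.ofReal_pos.2 (Real.sqrt_pos.2 hn')).ne'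
  have hAm : ∀ f ∈ G '' Θ₀, Measurable f := by
    rintro _ ⟨θ, hθ, rfl⟩
    exact hA1 θ (hsub hθ)
  have hAF : G '' Θ₀ ⊆ SAA.objectiveClass Θ G := by
    rintro _ ⟨θ, hθ, rfl⟩
    exact ⟨θ, hsub hθ, rfl⟩
  have hFξ : ∀ f ∈ SAA.objectiveClass Θ G, ∀ x, |f x| ≤ ξ x := by
    rintro _ ⟨θ, hθ, rfl⟩ x
    exact hA2.2.2.2 x θ hθ
  set M : (Fin n → SAA.Euc d) → ℝ≥0∞ :=
    fun z => ⨆ f ∈ G '' Θ₀, ‖∑ j, (f (z j) - ∫ x, f x ∂PZ)‖ₑ with hM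
  have hMm : Measurable M := SAA.measurable_biSup_enorm (hcount.image G) fun f hf => by
    have := hAm f hf
    fun_prop
  calc ∫⁻ ω, ‖SAA.scaledError Θ G PZ Z n ω‖ₑ ∂P = ∫⁻ ω, ‖W n ω‖ₑ ∂P :=
        lintegral_congr_ae ((hae n hn).mono fun ω hω => by simp only [hω])
    _ ≤ ∫⁻ ω, (ENNReal.ofReal √n)⁻¹ * M (Y n ω) ∂P :=
        lintegral_mono fun ω => SAA.enorm_sqrt_mul_iInf_sub_iInf_le hsub hne hA2 hn (Y n ω)
    _ = (ENNReal.ofReal √n)⁻¹ * ∫⁻ z, M z ∂(Measure.pi fun _ : Fin n => PZ) := by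
        rw [lintegral_const_mul (f := fun ω => M (Y n ω)) _ (hMm.comp (hYm n)), ← hYlaw n, lintegral_map hMm (hYm n)]
    _ ≤ (ENNReal.ofReal √n)⁻¹ * (ENNReal.ofReal √n *
          (ENNReal.ofReal (8 * √2 * (∫ x, ξ x ^ 2 ∂PZ + 1)) *
            SAA.entropyIntegral (SAA.objectiveClass Θ G) ξ (1 / 2))) := by
        gcongr
        exact SAA.lintegral_biSup_centered_le_entropyIntegral hn PZ (hcount.image G) hAF
          ((hne.image G).mono hAF) hAm hA2.2.1 hξ hFξ hJ.ne
    _ = _ := by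
        rw [← mul_assoc, ENNReal.inv_mul_cancel hs ENNReal.ofReal_ne_top, one_mul]
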